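/- Let $K\subset S^3$ be a (tame) knot, i.e. a locally flat subset homeomorphic to a circle, and let $p:\Sigma_2(K)\to S^3$ be the double cover of $S^3$ branched along $K$. Suppose that $\pi_1(\Sigma_2(K))$ has only cyclic $SO(3)$ representations, i.e. the image of every homomorphism $\pi_1(\Sigma_2(K))\to SO(3)$ is contained in a cyclic subgroup of $SO(3)$. Then $K$ is $SU(2)$-simple: if $m\in\pi_1(S^3\setminus K)$ is a meridian (for any choice of base point), then every homomorphism $\rho:\pi_1(S^3\setminus K)\to SU(2)$ for which $\rho(m)$ is conjugate in $SU(2)$ to $\mathbf i=\begin{pmatrix} i&0\\0&-i\end{pmatrix}$ (equivalently, $\rho(m)$ is trace-free) is binary dihedral. Here a meridian is a loop that runs from the base point along a path to a point near $K$, goes once (in either direction) around the boundary of a small disc meeting $K$ transversally in exactly one interior point, and returns along the same path. The representation $\rho$ is called binary dihedral if the image of $\pi\circ\rho$, where $\pi:SU(2)\to SO(3)$ is the standard two-fold covering homomorphism, is contained in a dihedral subgroup of $SO(3)$, that is, in a subgroup generated by rotations of one fixed plane in $\mathbb R^3$ and elements of $SO(3)$ that restrict to reflections of that plane. -/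

import Mathlib

open Topology Matrix

noncomputable section

/-! ### `SU(2)`, `SO(3)` and the two-fold covering between them -/

/-- The special unitary group `SU(2)`. -/
abbrev SU2 : Type := Matrix.specialUnitaryGroup (Fin 2) ℂ

/-- The special orthogonal group `SO(3)`. -/
abbrev SO3 : Type := Matrix.specialOrthogonalGroup (Fin 3) ℝ

/-- The Pauli matrices. -/
def pauli : Fin 3 → Matrix (Fin 2) (Fin 2) ℂ :=
  ![!![0, 1; 1, 0], !![0, -Complex.I; Complex.I, 0], !![1, 0; 0, -1]]

/-- The matrix, in the orthogonal basis of Pauli matrices, of the conjugation action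
`X ↦ U X U*` on the three-dimensional real vector space of trace-free Hermitian matrices:
`U σ_k U* = ∑ j, R_jk σ_j`, where `R_jk = (1/2) tr (σ_j U σ_k U*)`. -/
def rotationMatrix (U : Matrix (Fin 2) (Fin 2) ℂ) : Matrix (Fin 3) (Fin 3) ℝ :=
  Matrix.of fun j k => (1 / 2 : ℝ) * (Matrix.trace (pauli j * U * pauli k * Uᴴ)).re

/-- An element of `SU(2)` in terms of four real numbers with square sum one. -/
theorem exists_coords_SU2 (U : SU2) : ∃ a b c d : ℝ,
    a ^ 2 + b ^ 2 + c ^ 2 + d ^ 2 = 1 ∧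
      (U : Matrix (Fin 2) (Fin 2) ℂ) = !![⟨a, b⟩, ⟨c, d⟩; ⟨-c, d⟩, ⟨a, -b⟩] := by
  obtain ⟨M, hM⟩ := U
  obtain ⟨hu, hd⟩ := Matrix.mem_specialUnitaryGroup_iff.1 hM
  have hadj : star M = M.adjugate := by
    have h1 : star M * M = 1 := Matrix.mem_unitaryGroup_iff'.1 hu
    calc star M = star M * (M * M.adjugate) := by rw [Matrix.mul_adjugate, hd]; simp
      _ = M.adjugate := by rw [← Matrix.mul_assoc, h1, Matrix.one_mul]
  rw [Matrix.adjugate_fin_two] at hadj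
  have e00 := congrFun (congrFun hadj 0) 0
  have e10 := congrFun (congrFun hadj 1) 0
  simp [Matrix.star_apply] at e00 e10
  have r00 := congrArg Complex.re e00
  have i00 := congrArg Complex.im e00
  have r10 := congrArg Complex.re e10
  have i10 := congrArg Complex.im e10
  simp at r00 i00 r10 i10
  rw [Matrix.det_fin_two] at hd
  have rd := congrArg Complex.re hd
  simp at rd
  refine ⟨(M 0 0).re, (M 0 0).im, (M 0 1).re, (M 0 1).im, ?_, ?_⟩
  · rw [← r00, ← i00, show (M 1 0).re = -(M 0 1).re by linarith,
      show (M 1 0).im = (M 0 1).im by linarith] at rd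
    nlinarith
  · ext j k
    fin_cases j <;> fin_cases k <;> apply Complex.ext <;> simp <;> linarith

/-- The rotation matrix in these coordinates. -/
theorem rotationMatrix_coords (a b c d : ℝ) :
    rotationMatrix !![⟨a, b⟩, ⟨c, d⟩; ⟨-c, d⟩, ⟨a, -b⟩] =
      !![a ^ 2 - b ^ 2 - c ^ 2 + d ^ 2, 2 * (a * b + c * d), 2 * (b * d - a * c);
        2 * (c * d - a * b), a ^ 2 - b ^ 2 + c ^ 2 - d ^ 2, 2 * (a * d + b * c);
        2 * (a * c + b * d), 2 * (b * c - a * d), a ^ 2 + b ^ 2 - c ^ 2 - d ^ 2] := by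
  ext j k
  fin_cases j <;> fin_cases k <;>
    simp [rotationMatrix, pauli, Matrix.trace_fin_two, Matrix.mul_apply, Fin.sum_univ_two] <;>
    ring

/-- The rotation matrix of an element of `SU(2)` is in `SO(3)`. -/
theorem rotationMatrix_mem (U : SU2) :
    rotationMatrix U ∈ Matrix.specialOrthogonalGroup (Fin 3) ℝ := by
  obtain ⟨a, b, c, d, h, hU⟩ := exists_coords_SU2 U
  rw [hU, rotationMatrix_coords, Matrix.mem_specialOrthogonalGroup_iff]
  have h2 : (a ^ 2 + b ^ 2 + c ^ 2 + d ^ 2) ^ 2 = 1 := by rw [h]; norm_num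
  have h3 : (a ^ 2 + b ^ 2 + c ^ 2 + d ^ 2) ^ 3 = 1 := by rw [h]; norm_num
  constructor
  · rw [Matrix.mem_orthogonalGroup_iff]
    ext j k
    fin_cases j <;> fin_cases k <;>
      simp [Matrix.mul_apply, Fin.sum_univ_three] <;>
      first
        | ring1
        | linear_combination h2
  · rw [Matrix.det_fin_three]
    simp
    rw [← h3]
    ring

/-- The rotation matrix is multiplicative on `SU(2)`. -/
theorem rotationMatrix_mul (U V : SU2) :
    rotationMatrix ((U * V : SU2) : Matrix (Fin 2) (Fin 2) ℂ) =
      rotationMatrix U * rotationMatrix V := by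
  obtain ⟨a, b, c, d, -, hU⟩ := exists_coords_SU2 U
  obtain ⟨a', b', c', d', -, hV⟩ := exists_coords_SU2 V
  have hUV : ((U * V : SU2) : Matrix (Fin 2) (Fin 2) ℂ) =
      !![⟨a * a' - b * b' - c * c' - d * d', a * b' + b * a' + c * d' - d * c'⟩,
          ⟨a * c' - b * d' + c * a' + d * b', a * d' + b * c' - c * b' + d * a'⟩;
        ⟨-(a * c' - b * d' + c * a' + d * b'), a * d' + b * c' - c * b' + d * a'⟩,
          ⟨a * a' - b * b' - c * c' - d * d', -(a * b' + b * a' + c * d' - d * c')⟩] := by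
    rw [Submonoid.coe_mul, hU, hV]
    ext j k
    fin_cases j <;> fin_cases k <;> apply Complex.ext <;>
      simp [Matrix.mul_apply, Fin.sum_univ_two] <;> ring
  rw [hUV, hU, hV, rotationMatrix_coords, rotationMatrix_coords, rotationMatrix_coords]
  ext j k
  fin_cases j <;> fin_cases k <;> simp [Matrix.mul_apply, Fin.sum_univ_three] <;> ring

/-- The covering homomorphism `π : SU(2) → SO(3)`: conjugation on trace-free Hermitian matrices
(equivalently, conjugation of unit quaternions on imaginary quaternions). -/
def coverSO3 : SU2 →* SO3 :=
  MonoidHom.mk' (fun U => ⟨rotationMatrix U, rotationMatrix_mem U⟩) fun U V =>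
    Subtype.ext (rotationMatrix_mul U V)

/-- The element `i` of `SU(2)`, the diagonal matrix with entries `i, -i`. -/
def quatI : SU2 :=
  ⟨!![Complex.I, 0; 0, -Complex.I], by
    rw [Matrix.mem_specialUnitaryGroup_iff, Matrix.mem_unitaryGroup_iff, Matrix.det_fin_two]
    constructor
    · ext j k
      fin_cases j <;> fin_cases k <;>
        simp [Matrix.mul_apply, Fin.sum_univ_two, Matrix.star_apply]
    · simp⟩

/-! ### Cyclic, dihedral and binary dihedral representations -/

/-- Every representation of `G` in `SO(3)` has its image contained in a cyclic subgroup. -/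
def HasOnlyCyclicSO3Reps (G : Type*) [Group G] : Prop :=
  ∀ ρ : G →* SO3, ∃ C : Subgroup SO3, IsCyclic C ∧ ρ.range ≤ C

/-- `A` is a rotation of the plane `nᗮ`, i.e. a rotation about the axis spanned by `n`. -/
def IsPlaneRotation (n : Fin 3 → ℝ) (A : SO3) : Prop :=
  (A : Matrix (Fin 3) (Fin 3) ℝ) *ᵥ n = n

/-- `A` restricts to a reflection of the plane `nᗮ`: it is the half-turn about the line spanned
by a nonzero vector `u` of that plane. -/
def IsPlaneReflection (n : Fin 3 → ℝ) (A : SO3) : Prop :=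
  ∃ u : Fin 3 → ℝ, u ≠ 0 ∧ u ⬝ᵥ n = 0 ∧ (A : Matrix (Fin 3) (Fin 3) ℝ) *ᵥ u = u ∧
    ∀ v : Fin 3 → ℝ, v ⬝ᵥ u = 0 → (A : Matrix (Fin 3) (Fin 3) ℝ) *ᵥ v = -v

/-- A dihedral subgroup of `SO(3)`: a subgroup generated by rotations and reflections of one
fixed plane. -/
def IsDihedralSubgroup (D : Subgroup SO3) : Prop :=
  ∃ n : Fin 3 → ℝ, n ≠ 0 ∧ ∃ S : Set SO3,
    (∀ A ∈ S, IsPlaneRotation n A ∨ IsPlaneReflection n A) ∧ D = Subgroup.closure S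

/-- A representation in `SO(3)` is dihedral if its image lies in a dihedral subgroup. -/
def IsDihedralRep {G : Type*} [Group G] (ρ : G →* SO3) : Prop :=
  ∃ D : Subgroup SO3, IsDihedralSubgroup D ∧ ρ.range ≤ D

/-- A representation in `SU(2)` is binary dihedral if its image in `SO(3)` is dihedral. -/
def IsBinaryDihedralRep {G : Type*} [Group G] (ρ : G →* SU2) : Prop :=
  IsDihedralRep (coverSO3.comp ρ)

/-! ### Knots, meridians and branched double covers -/

/-- The 3-sphere. -/
abbrev S3 : Type := Metric.sphere (0 : EuclideanSpace ℝ (Fin 4)) 1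

/-- A flat chart for `K ⊆ S³`: a homeomorphism from an open subset of `S³` onto `ℂ × ℝ = ℝ³`
that carries the part of `K` in that subset onto the axis `{0} × ℝ`. -/
structure FlatChart (K : Set S3) where
  /-- The underlying chart. -/
  chart : OpenPartialHomeomorph S3 (ℂ × ℝ)
  target_eq : chart.target = Set.univ
  mem_iff : ∀ x ∈ chart.source, x ∈ K ↔ (chart x).1 = 0

/-- A (tame) knot: a subset of `S³` homeomorphic to the circle and locally flat. -/
structure IsKnot (K : Set S3) : Prop where
  circle : Nonempty (K ≃ₜ Circle)
  locallyFlat : ∀ x ∈ K, ∃ e : FlatChart K, x ∈ e.chart.source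

namespace FlatChart

variable {K : Set S3} (e : FlatChart K)

theorem symm_mem_compl (z : Circle) : e.chart.symm ((z : ℂ), (0 : ℝ)) ∈ Kᶜ := by
  intro h
  have ht : ((z : ℂ), (0 : ℝ)) ∈ e.chart.target := by rw [e.target_eq]; trivial
  rw [e.mem_iff _ (e.chart.map_target ht), e.chart.right_inv ht] at h
  exact z.coe_ne_zero h

/-- The unit circle in the disc `ℂ × {0}`, which meets `K` transversally in its centre, as a map
to the complement of `K`. -/
def circleMap : C(Circle, (Kᶜ : Set S3)) where
  toFun z := ⟨e.chart.symm ((z : ℂ), (0 : ℝ)), e.symm_mem_compl z⟩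
  continuous_toFun := by
    refine Continuous.subtype_mk ?_ _
    have h : Continuous e.chart.symm := by
      have := e.chart.continuousOn_symm
      rwa [e.target_eq, continuousOn_univ] at this
    exact h.comp (by fun_prop)

/-- The loop running once around the knot along the unit circle of `ℂ × {0}`. -/
def circleLoop : Path (e.circleMap 1) (e.circleMap 1) where
  toFun t := e.circleMap (Circle.exp (2 * Real.pi * t))
  continuous_toFun := by fun_prop
  source' := by simp
  target' := by simp

end FlatChart

/-- The knot group at the base point `x₀`: the fundamental group of the complement of `K`. -/
abbrev KnotGroup (K : Set S3) (x₀ : (Kᶜ : Set S3)) : Type :=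
  FundamentalGroup (Kᶜ : Set S3) x₀

/-- Meridians based at `x₀`: a path from `x₀` to a point near the knot, followed by the boundary
circle of a small disc meeting the knot transversally in one interior point, followed by the path
backwards. Both orientations of the circle occur, as a flat chart may be composed with
`(z, t) ↦ (conj z, t)`. -/
def IsMeridian {K : Set S3} {x₀ : (Kᶜ : Set S3)} (m : KnotGroup K x₀) : Prop :=
  ∃ (e : FlatChart K) (γ : Path x₀ (e.circleMap 1)),
    m = FundamentalGroup.fromPath
      (Path.Homotopic.Quotient.mk (γ.trans (e.circleLoop.trans γ.symm)))

/-- The space `R(K; i)` of meridian-traceless `SU(2)` representations, with respect to a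
meridian `m`: the image of `m` is conjugate to `i`. -/
def meridianTracelessReps {K : Set S3} {x₀ : (Kᶜ : Set S3)} (m : KnotGroup K x₀) :
    Set (KnotGroup K x₀ →* SU2) :=
  {ρ | IsConj (ρ m) quatI}

/-- `K` is `SU(2)`-simple if `R(K; i)` contains only binary dihedral representations; all choices
of a base point and of a meridian are considered. -/
def IsSU2Simple (K : Set S3) : Prop :=
  ∀ (x₀ : (Kᶜ : Set S3)) (m : KnotGroup K x₀), IsMeridian m →
    ∀ ρ ∈ meridianTracelessReps m, IsBinaryDihedralRep ρ

/-- `p : Y → S³` is a double cover branched along `K`: it is a two-sheeted covering over the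
complement of `K`, and around every point of `K` it is, in suitable coordinates of the base (flat
for `K`) and of the whole preimage, the map `(z, t) ↦ (z², t)`. The local form forces the
monodromy of a meridian to be non-trivial, so for a knot `Y` is connected and is the branched
double cover of `K`, unique up to homeomorphism over `S³`. -/
structure IsBranchedDoubleCover {Y : Type*} [TopologicalSpace Y] (p : Y → S3) (K : Set S3) :
    Prop where
  continuous : Continuous p
  covering : IsCoveringMapOn p Kᶜ
  two_sheeted : ∀ x ∈ Kᶜ, (p ⁻¹' {x}).ncard = 2
  branched : ∀ x ∈ K, ∃ (e : FlatChart K) (f : OpenPartialHomeomorph Y (ℂ × ℝ)),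
    x ∈ e.chart.source ∧ f.source = p ⁻¹' e.chart.source ∧ f.target = Set.univ ∧
      ∀ y ∈ f.source, e.chart (p y) = ((f y).1 ^ 2, (f y).2)

end

/-! The element $i^2=-1$ lies in the kernel of `coverSO3`, so composing a meridian-traceless
representation with `coverSO3` kills the square of the meridian. A small loop around the branch set
upstairs projects to such a square. The representation, pulled back to the unbranched part of the
double cover, therefore extends over the branch set. By hypothesis the extension has cyclic image,
so the image $L$ of the pulled-back representation fixes a vector. The image $R$ of the whole knot
group contains $L$ with index at most two, and `SO3.exists_plane` concludes: if $L\ne1$, the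
elements of $R$ preserve the axis of $L$ up to sign; if $L=1$, then $R$ has at most two elements.

The extension avoids presentations of groups. A homomorphism is encoded as a `Transport`, a functor
from the fundamental groupoid. If it has potentials on small sets around every point, including the
missing ones, these glue to a bundle with discrete fibre over the whole space, and lifting paths to
this covering is the extended transport (`Transport.IsLocallyFlat.exists_extension`). At a branch
point the potential is $g(2\log z,t)$, single-valued because the meridian holonomy squares to one
(`IsBranchedDoubleCover.exists_isFlatOn_of_mem`). One meridian suffices, since the condition spreads
along the connected knot (`IsKnot.circleLoop_sq_eq_one`). -/

noncomputable section

open unitInterval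

/-! ### Rotations, axes and dihedral subgroups of `SO(3)`. -/

namespace SO3

theorem dotProduct_mulVec_mulVec (A : SO3) (v w : Fin 3 → ℝ) :
    ((A : Matrix (Fin 3) (Fin 3) ℝ) *ᵥ v) ⬝ᵥ ((A : Matrix (Fin 3) (Fin 3) ℝ) *ᵥ w) = v ⬝ᵥ w := by
  have h : (A : Matrix (Fin 3) (Fin 3) ℝ)ᵀ * A = 1 :=
    (Matrix.mem_orthogonalGroup_iff' _ _).1 (Matrix.mem_specialOrthogonalGroup_iff.1 A.2).1
  rw [Matrix.dotProduct_mulVec, ← Matrix.mulVec_transpose, Matrix.mulVec_mulVec, h,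
    Matrix.one_mulVec]

theorem mul_mulVec (A B : SO3) (v : Fin 3 → ℝ) :
    ((A * B : SO3) : Matrix (Fin 3) (Fin 3) ℝ) *ᵥ v =
      (A : Matrix (Fin 3) (Fin 3) ℝ) *ᵥ ((B : Matrix (Fin 3) (Fin 3) ℝ) *ᵥ v) := by
  rw [Matrix.mulVec_mulVec]; rfl

theorem one_mulVec (v : Fin 3 → ℝ) : ((1 : SO3) : Matrix (Fin 3) (Fin 3) ℝ) *ᵥ v = v :=
  Matrix.one_mulVec v

theorem inv_mulVec_eq_iff (A : SO3) (v w : Fin 3 → ℝ) :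
    ((A⁻¹ : SO3) : Matrix (Fin 3) (Fin 3) ℝ) *ᵥ v = w ↔
      v = (A : Matrix (Fin 3) (Fin 3) ℝ) *ᵥ w := by
  constructor
  · rintro rfl
    rw [← mul_mulVec, mul_inv_cancel, one_mulVec]
  · rintro rfl
    rw [← mul_mulVec, inv_mul_cancel, one_mulVec]

/-- Every rotation has an axis. -/
theorem exists_fixed_vector (A : SO3) :
    ∃ n : Fin 3 → ℝ, n ≠ 0 ∧ (A : Matrix (Fin 3) (Fin 3) ℝ) *ᵥ n = n := by
  obtain ⟨A, hA⟩ := A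
  obtain ⟨ho, hd⟩ := Matrix.mem_specialOrthogonalGroup_iff.1 hA
  have ho' : A * Aᵀ = 1 := (Matrix.mem_orthogonalGroup_iff _ _).1 ho
  have h : (A - 1).det = 0 := by
    -- Orthogonality gives $A-1=A(1-A)^T$; the sign in odd dimension then forces the determinant to
    -- vanish.
    have h1 : (A - 1).det = (1 - A).det := by
      calc (A - 1).det = (A * (1 - A)ᵀ).det := by
            rw [Matrix.transpose_sub, Matrix.mul_sub, ho']; simp
        _ = (1 - A).det := by rw [Matrix.det_mul, hd, Matrix.det_transpose, one_mul]
    have h2 : (1 - A).det = -(A - 1).det := by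
      rw [← neg_sub A 1, Matrix.det_neg]; simp
      norm_num
    linarith
  obtain ⟨n, hn, h0⟩ := Matrix.exists_mulVec_eq_zero_iff.2 h
  refine ⟨n, hn, ?_⟩
  rw [Matrix.sub_mulVec, Matrix.one_mulVec, sub_eq_zero] at h0
  exact h0

/-- Having determinant one, $A$ preserves triple products, so it also fixes $u\times w$.
Orthogonality makes $u,w,u\times w$ a basis, of determinant $|u|^2|w|^2$. -/
theorem eq_one_of_orthogonal_fixed (A : SO3) {u w : Fin 3 → ℝ} (hu : u ≠ 0) (hw : w ≠ 0)
    (huw : w ⬝ᵥ u = 0) (hAu : (A : Matrix (Fin 3) (Fin 3) ℝ) *ᵥ u = u)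
    (hAw : (A : Matrix (Fin 3) (Fin 3) ℝ) *ᵥ w = w) : A = 1 := by
  have hrow : ∀ v : Fin 3 → ℝ, v ᵥ* (A : Matrix (Fin 3) (Fin 3) ℝ)ᵀ =
      (A : Matrix (Fin 3) (Fin 3) ℝ) *ᵥ v := fun v => Matrix.vecMul_transpose _ _
  have hdetA : (A : Matrix (Fin 3) (Fin 3) ℝ).det = 1 :=
    (Matrix.mem_specialOrthogonalGroup_iff.1 A.2).2
  have hmul : ∀ v₁ v₂ v₃ : Fin 3 → ℝ, Matrix.of ![v₁, v₂, v₃] *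
      (A : Matrix (Fin 3) (Fin 3) ℝ)ᵀ = Matrix.of ![(A : Matrix (Fin 3) (Fin 3) ℝ) *ᵥ v₁,
        (A : Matrix (Fin 3) (Fin 3) ℝ) *ᵥ v₂, (A : Matrix (Fin 3) (Fin 3) ℝ) *ᵥ v₃] := by
    intro v₁ v₂ v₃
    ext i j
    fin_cases i
    · exact congrFun (hrow v₁) j
    · exact congrFun (hrow v₂) j
    · exact congrFun (hrow v₃) j
  have hAx : (A : Matrix (Fin 3) (Fin 3) ℝ) *ᵥ (crossProduct u w) = crossProduct u w := by
    refine dotProduct_eq _ _ fun z => ?_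
    rw [dotProduct_comm, dotProduct_comm _ z]
    have hz : z = (A : Matrix (Fin 3) (Fin 3) ℝ) *ᵥ
      (((A⁻¹ : SO3) : Matrix (Fin 3) (Fin 3) ℝ) *ᵥ z) := (inv_mulVec_eq_iff A z _).1 rfl
    set y := ((A⁻¹ : SO3) : Matrix (Fin 3) (Fin 3) ℝ) *ᵥ z
    rw [hz, dotProduct_mulVec_mulVec, triple_product_eq_det, triple_product_eq_det]
    have h := congrArg Matrix.det (hmul y u w)
    rw [Matrix.det_mul, Matrix.det_transpose, hdetA, mul_one, hAu, hAw] at h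
    exact h
  have hdet : Matrix.det ![u, w, crossProduct u w] ≠ 0 := by
    rw [← triple_product_eq_det, triple_product_permutation, triple_product_permutation,
      cross_dot_cross, huw, mul_zero, sub_zero]
    exact mul_ne_zero (fun h => hu (dotProduct_self_eq_zero.1 h))
      (fun h => hw (dotProduct_self_eq_zero.1 h))
  have hB := hmul u w (crossProduct u w)
  rw [hAu, hAw, hAx] at hB
  have hunit : IsUnit (Matrix.of ![u, w, crossProduct u w]) :=
    (Matrix.isUnit_iff_isUnit_det _).2 (isUnit_iff_ne_zero.2 hdet)
  have hT : (A : Matrix (Fin 3) (Fin 3) ℝ)ᵀ = 1 := hunit.mul_left_cancel (by rw [hB, mul_one])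
  exact Subtype.ext (by simpa using congrArg Matrix.transpose hT)

theorem exists_smul_of_fixed {A : SO3} (hA : A ≠ 1) {u w : Fin 3 → ℝ} (hu : u ≠ 0)
    (hAu : (A : Matrix (Fin 3) (Fin 3) ℝ) *ᵥ u = u)
    (hAw : (A : Matrix (Fin 3) (Fin 3) ℝ) *ᵥ w = w) : ∃ k : ℝ, w = k • u := by
  have huu : u ⬝ᵥ u ≠ 0 := fun h => hu (dotProduct_self_eq_zero.1 h)
  refine ⟨(w ⬝ᵥ u) / (u ⬝ᵥ u), ?_⟩
  by_contra hne
  refine hA (eq_one_of_orthogonal_fixed A hu (w := w - ((w ⬝ᵥ u) / (u ⬝ᵥ u)) • u)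
    (sub_ne_zero.2 hne) ?_ hAu ?_)
  · rw [sub_dotProduct, smul_dotProduct, smul_eq_mul, div_mul_cancel₀ _ huu, sub_self]
  · rw [Matrix.mulVec_sub, Matrix.mulVec_smul, hAu, hAw]

/-- The axis $u$ of $A$ is orthogonal to $n$, as $\langle u,n\rangle=-\langle u,n\rangle$. Since
$A^2$ fixes both, $A^2=1$. For $v\perp u$ the vector $v+Av$ is then fixed and orthogonal to $u$, so
it vanishes unless $A=1$. -/
theorem isPlaneReflection_of_mulVec_eq_neg {A : SO3} {n : Fin 3 → ℝ} (hn : n ≠ 0)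
    (h : (A : Matrix (Fin 3) (Fin 3) ℝ) *ᵥ n = -n) : IsPlaneReflection n A := by
  obtain ⟨u, hu, hAu⟩ := exists_fixed_vector A
  have hun : u ⬝ᵥ n = 0 := by
    have := dotProduct_mulVec_mulVec A u n
    rw [hAu, h, dotProduct_neg] at this
    linarith
  have hsq : A * A = 1 := by
    refine eq_one_of_orthogonal_fixed _ hn hu hun ?_ ?_
    · rw [mul_mulVec, h, Matrix.mulVec_neg, h, neg_neg]
    · rw [mul_mulVec, hAu, hAu]
  refine ⟨u, hu, hun, hAu, fun v hv => ?_⟩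
  by_contra hne
  have hA : A = 1 := by
    refine eq_one_of_orthogonal_fixed A hu (w := v + (A : Matrix (Fin 3) (Fin 3) ℝ) *ᵥ v)
      (fun h0 => hne (eq_neg_of_add_eq_zero_right h0)) ?_ hAu ?_
    · have := dotProduct_mulVec_mulVec A v u
      rw [hAu] at this
      rw [add_dotProduct, this, hv, add_zero]
    · rw [Matrix.mulVec_add, ← mul_mulVec, hsq, one_mulVec, add_comm]
  rw [hA, one_mulVec] at h
  exact hn (self_eq_neg.1 h)

/-- The elements of a cyclic subgroup of `SO(3)` have a common axis. -/
theorem exists_common_fixed_vector (C : Subgroup SO3) (hC : IsCyclic C) :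
    ∃ n : Fin 3 → ℝ, n ≠ 0 ∧ ∀ A ∈ C, (A : Matrix (Fin 3) (Fin 3) ℝ) *ᵥ n = n := by
  obtain ⟨c, hc⟩ := hC.exists_generator
  obtain ⟨n, hn, hcn⟩ := exists_fixed_vector (c : SO3)
  refine ⟨n, hn, fun A hA => ?_⟩
  let St : Subgroup SO3 :=
    { carrier := {B | (B : Matrix (Fin 3) (Fin 3) ℝ) *ᵥ n = n}
      one_mem' := one_mulVec n
      mul_mem' := fun {B B'} hB hB' => by
        simp only [Set.mem_ofPred_eq] at hB hB' ⊢
        rw [mul_mulVec, hB', hB]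
      inv_mem' := fun {B} hB => (inv_mulVec_eq_iff B n n).2 (Eq.symm hB) }
  obtain ⟨k, hk⟩ := Subgroup.mem_zpowers_iff.1 (hc ⟨A, hA⟩)
  have : A = (c : SO3) ^ k := by rw [← Subgroup.coe_zpow, hk]
  rw [this]
  exact St.zpow_mem (x := (c : SO3)) hcn k

/-- A subgroup of `SO(3)` that has a subgroup of index at most two whose elements have a common
axis consists of rotations and reflections of one plane. -/
theorem exists_plane {R L : Subgroup SO3} (hLR : L ≤ R)
    (hidx : ∀ g ∈ R, ∀ h ∈ R, g ∉ L → h ∉ L → g * h⁻¹ ∈ L)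
    (hfix : ∃ n : Fin 3 → ℝ, n ≠ 0 ∧ ∀ A ∈ L, (A : Matrix (Fin 3) (Fin 3) ℝ) *ᵥ n = n) :
    ∃ n : Fin 3 → ℝ, n ≠ 0 ∧ ∀ A ∈ R, IsPlaneRotation n A ∨ IsPlaneReflection n A := by
  -- A trivial $L$ carries no axis; the axis of the at most one nontrivial element of $R$ replaces
  -- it.
  by_cases hL : L = ⊥
  · subst hL
    by_cases hR : ∃ g ∈ R, g ≠ 1
    · obtain ⟨g, hg, hg1⟩ := hR
      obtain ⟨n, hn, hgn⟩ := exists_fixed_vector g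
      refine ⟨n, hn, fun A hA => Or.inl ?_⟩
      by_cases hA1 : A = 1
      · rw [hA1]; exact one_mulVec n
      · have := hidx A hA g hg (by simpa using hA1) (by simpa using hg1)
        rw [Subgroup.mem_bot, mul_inv_eq_one] at this
        rw [this]; exact hgn
    · push Not at hR
      obtain ⟨n, hn, -⟩ := hfix
      exact ⟨n, hn, fun A hA => Or.inl (by rw [hR A hA]; exact one_mulVec n)⟩
  · obtain ⟨a, haL, ha⟩ := (Subgroup.ne_bot_iff_exists_ne_one.1 hL : ∃ a : L, a ≠ 1) |>
      fun ⟨a, ha⟩ => (⟨a, a.2, fun h => ha (Subtype.ext h)⟩ : ∃ a : SO3, a ∈ L ∧ a ≠ 1)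
    obtain ⟨n, hn, hfix⟩ := hfix
    refine ⟨n, hn, fun g hg => ?_⟩
    by_cases hgL : g ∈ L
    · exact Or.inl (hfix g hgL)
    -- Both $ga$ and $g$ lie outside $L$. Hence $a$ fixes $g^{-1}n$ as well as $n$; having a single
    -- axis, it forces $g^{-1}n=\pm n$.
    have hconj : g * a * g⁻¹ ∈ L := by
      refine hidx _ (R.mul_mem hg (hLR haL)) g hg (fun h => hgL ?_) hgL
      simpa using L.mul_mem h (L.inv_mem haL)
    set w := ((g⁻¹ : SO3) : Matrix (Fin 3) (Fin 3) ℝ) *ᵥ n with hw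
    have hgw : n = (g : Matrix (Fin 3) (Fin 3) ℝ) *ᵥ w := (inv_mulVec_eq_iff g n w).1 hw.symm
    have haw : (a : Matrix (Fin 3) (Fin 3) ℝ) *ᵥ w = w := by
      have h1 := hfix _ hconj
      rw [mul_mulVec, ← hw, mul_mulVec] at h1
      rw [hw, eq_comm, inv_mulVec_eq_iff, ← hw]
      exact h1.symm
    obtain ⟨k, hk⟩ := exists_smul_of_fixed ha hn (hfix a haL) haw
    have hnn : n ⬝ᵥ n ≠ 0 := fun h => hn (dotProduct_self_eq_zero.1 h)
    have hk2 : k ^ 2 = 1 := by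
      have h1 := dotProduct_mulVec_mulVec g w w
      rw [← hgw, hk, smul_dotProduct, dotProduct_smul, smul_eq_mul, smul_eq_mul] at h1
      have : (k ^ 2 - 1) * (n ⬝ᵥ n) = 0 := by linarith
      rcases mul_eq_zero.1 this with h | h
      · linarith
      · exact absurd h hnn
    rcases (mul_self_eq_one_iff.1 ((sq k).symm.trans hk2)) with h | h
    · left
      rw [IsPlaneRotation]
      nth_rewrite 2 [hgw]
      rw [hk, h, one_smul]
    · right
      refine isPlaneReflection_of_mulVec_eq_neg hn ?_
      nth_rewrite 2 [hgw]
      rw [hk, h, neg_one_smul, Matrix.mulVec_neg, neg_neg]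

end SO3

/-! ### Transports: functors from the fundamental groupoid to a group. -/

/-- A transport of a group `Γ` along the paths of a space: a function on paths that is invariant
under homotopies with fixed end points and multiplicative under concatenation. -/
structure Transport (X Γ : Type*) [TopologicalSpace X] [Group Γ] where
  /-- The value on a path. -/
  toFun : ∀ {x y : X}, Path x y → Γ
  homotopic : ∀ {x y : X} (γ γ' : Path x y), γ.Homotopic γ' → toFun γ = toFun γ'
  trans : ∀ {x y z : X} (γ : Path x y) (γ' : Path y z),
    toFun (γ.trans γ') = toFun γ' * toFun γ

namespace Transport

variable {X Z Γ : Type*} [TopologicalSpace X] [TopologicalSpace Z] [Group Γ]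

theorem congr (T : Transport X Γ) {x y x' y' : X} (γ : Path x y) (γ' : Path x' y')
    (h : ∀ t, γ t = γ' t) : T.toFun γ = T.toFun γ' := by
  obtain rfl : x = x' := by simpa using h 0
  obtain rfl : y = y' := by simpa using h 1
  congr 1
  ext t
  exact h t

theorem refl (T : Transport X Γ) (x : X) : T.toFun (Path.refl x) = 1 := by
  have h := T.trans (Path.refl x) (Path.refl x)
  rw [Path.refl_trans_refl] at h
  exact by simpa using h

theorem symm (T : Transport X Γ) {x y : X} (γ : Path x y) : T.toFun γ.symm = (T.toFun γ)⁻¹ := by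
  rw [eq_inv_iff_mul_eq_one, ← T.trans, ← T.refl x]
  exact T.homotopic _ _ ⟨(Path.Homotopy.reflTransSymm γ).symm⟩

/-- The transport pulled back along a continuous map. -/
def comap (T : Transport X Γ) (f : C(Z, X)) : Transport Z Γ where
  toFun γ := T.toFun (γ.map f.continuous)
  homotopic γ γ' h := T.homotopic _ _ (h.map f)
  trans γ γ' := by rw [Path.map_trans, T.trans]

/-- The homomorphism on the fundamental group given by a transport. -/
def hom (T : Transport X Γ) (x : X) : FundamentalGroup X x →* Γ :=
  MonoidHom.mk' (fun α => Quotient.lift (s := Path.Homotopic.setoid x x) T.toFun T.homotopic α)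
    fun α β => by
      induction α using Quotient.inductionOn with | _ γ
      induction β using Quotient.inductionOn with | _ γ'
      exact T.trans γ' γ

theorem hom_mk (T : Transport X Γ) {x : X} (γ : Path x x) :
    T.hom x (FundamentalGroup.fromPath (Path.Homotopic.Quotient.mk γ)) = T.toFun γ := rfl

theorem mem_range_hom_iff (T : Transport X Γ) {x : X} {g : Γ} :
    g ∈ (T.hom x).range ↔ ∃ γ : Path x x, T.toFun γ = g := by
  constructor
  · rintro ⟨α, rfl⟩
    induction α using Quotient.inductionOn with | _ γ
    exact ⟨γ, rfl⟩
  · rintro ⟨γ, rfl⟩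
    exact ⟨_, T.hom_mk γ⟩

/-- On a simply connected space a transport is a coboundary. -/
theorem exists_potential [SimplyConnectedSpace Z] (T : Transport Z Γ) :
    ∃ g : Z → Γ, ∀ {a b : Z} (γ : Path a b), T.toFun γ = g b * (g a)⁻¹ := by
  obtain ⟨z₀⟩ := (inferInstance : Nonempty Z)
  refine ⟨fun z => T.toFun (PathConnectedSpace.somePath z₀ z), fun {a b} γ => ?_⟩
  rw [eq_mul_inv_iff_mul_eq, ← T.trans]
  exact T.homotopic _ _ (SimplyConnectedSpace.paths_homotopic _ _)

/-- A homomorphism from the fundamental group of a path connected space extends to a transport. -/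
theorem exists_of_hom [PathConnectedSpace X] {x₀ : X} (φ : FundamentalGroup X x₀ →* Γ) :
    ∃ T : Transport X Γ,
      (∀ γ : Path x₀ x₀,
        T.toFun γ = φ (FundamentalGroup.fromPath (Path.Homotopic.Quotient.mk γ))) ∧
      ∀ x, ∃ γ : Path x₀ x, T.toFun γ = 1 := by
  classical
  -- The chosen path to $x_0$ itself must be constant, so that the transport of a loop is exactly
  -- its image under $\varphi$.
  let c : ∀ x, Path.Homotopic.Quotient x₀ x := fun x =>
    if h : x₀ = x then (Path.Homotopic.Quotient.refl x₀).cast rfl h.symm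
    else .mk (PathConnectedSpace.somePath x₀ x)
  have hc : c x₀ = .refl x₀ := by simp [c]
  let τ : ∀ {x y : X}, Path.Homotopic.Quotient x y → Γ := fun {x y} α =>
    φ (FundamentalGroup.fromPath (((c x).trans α).trans (c y).symm))
  have hτ : ∀ {x y z : X} (α : Path.Homotopic.Quotient x y) (β : Path.Homotopic.Quotient y z),
      τ (α.trans β) = τ β * τ α := by
    intro x y z α β
    simp only [τ]
    rw [← map_mul, FundamentalGroup.mul_def]
    congr 1
    simp only [FundamentalGroup.fromPath, FundamentalGroup.fromArrow]
    simp only [Path.Homotopic.Quotient.trans_assoc]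
    rw [← Path.Homotopic.Quotient.trans_assoc (c y).symm (c y),
      Path.Homotopic.Quotient.symm_trans, Path.Homotopic.Quotient.refl_trans]
  refine ⟨⟨fun γ => τ (.mk γ), fun γ γ' h => ?_, fun γ γ' => ?_⟩, fun γ => ?_, fun x => ?_⟩
  · rw [Path.Homotopic.Quotient.eq.2 h]
  · exact hτ (.mk γ) (.mk γ')
  · simp only [τ, hc]
    rw [Path.Homotopic.Quotient.refl_trans]
    congr 1
    exact Path.Homotopic.Quotient.trans_refl _
  · obtain ⟨γ, hγ⟩ := Path.Homotopic.Quotient.mk_surjective (c x)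
    refine ⟨γ, ?_⟩
    simp only [τ, hc, hγ]
    rw [Path.Homotopic.Quotient.refl_trans, Path.Homotopic.Quotient.trans_symm]
    exact φ.map_one

end Transport

/-- A covering space with a group acting simply transitively on its fibres, described by a fibre
coordinate, gives a transport on the base. -/
theorem IsCoveringMap.exists_transport {E Y Γ : Type*} [TopologicalSpace E] [TopologicalSpace Y]
    [Group Γ] {q : E → Y} (hq : IsCoveringMap q) (κ : E → Γ)
    (hκ : ∀ y, ∃ e, q e = y ∧ κ e = 1) (R : Γ → E → E) (hRc : ∀ c, Continuous (R c))
    (hRq : ∀ c e, q (R c e) = q e) (hRκ : ∀ c e, κ (R c e) = κ e * c)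
    (hinj : ∀ e e', q e = q e' → κ e = κ e' → e = e') :
    ∃ T : Transport Y Γ, ∀ {y y' : Y} (γ : Path y y') (L : C(I, E)), (∀ t, q (L t) = γ t) →
      T.toFun γ = κ (L 1) * (κ (L 0))⁻¹ := by
  choose s hsq hsκ using hκ
  have hs0 : ∀ {y y' : Y} (γ : Path y y'), (γ : C(I, Y)) 0 = q (s y) := fun {y y'} γ => by
    rw [hsq]; exact γ.source
  have key : ∀ {y y' : Y} (γ : Path y y') (L : C(I, E)), (∀ t, q (L t) = γ t) →
      κ (hq.liftPath γ (s y) (hs0 γ) 1) = κ (L 1) * (κ (L 0))⁻¹ := by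
    intro y y' γ L hL
    -- Right translation moves any lift to the one starting at coordinate $1$ and leaves
    -- $\kappa(L_1)\kappa(L_0)^{-1}$ unchanged.
    let L' : C(I, E) := ⟨fun t => R (κ (L 0))⁻¹ (L t), (hRc _).comp L.continuous⟩
    have : L' = hq.liftPath γ (s y) (hs0 γ) := by
      refine (hq.eq_liftPath_iff' _).2 ⟨?_, hinj _ _ ?_ ?_⟩
      · ext t
        exact (hRq _ _).trans (hL t)
      · exact (hRq _ _).trans ((hL 0).trans (γ.source.trans (hsq y).symm))
      · rw [hsκ]
        exact (hRκ _ _).trans (mul_inv_cancel _)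
    rw [← this]
    exact hRκ _ _
  refine ⟨⟨fun {y y'} γ => κ (hq.liftPath γ (s y) (hs0 γ) 1), fun {y y'} γ γ' h => ?_,
    fun {x y z} γ γ' => ?_⟩, fun γ L hL => key γ L hL⟩
  · exact congrArg κ (hq.liftPath_apply_one_eq_of_homotopicRel h _ _ _)
  · have h1 := hq.liftPath_trans (hsq x).symm γ γ'
    have h2 := congrArg (fun L : C(I, E) => κ (L 1)) h1
    refine h2.trans ?_
    rw [key γ' (hq.liftPath γ' (hq.liftPath γ (s x) (hs0 γ) 1) (by
      have := congrFun (hq.liftPath_lifts γ (s x) (hs0 γ)) 1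
      refine Eq.trans ?_ this.symm
      simp)) (fun t => congrFun (hq.liftPath_lifts γ' _ _) t), hq.liftPath_zero]
    simp

/-! ### Extension of a locally flat transport from a subspace. -/

instance : SimplyConnectedSpace I :=
  have : ContractibleSpace I := (convex_Icc (0 : ℝ) 1).contractibleSpace ⟨0, by simp⟩
  inferInstance

instance : LocallyPathConnectedSpace I :=
  (convex_Icc (0 : ℝ) 1).locallyPathConnectedSpace

namespace Transport

variable {Y Γ : Type*} [TopologicalSpace Y] [Group Γ] {S : Set Y}

/-- A function that trivializes, over the set `U`, a transport on the subspace `S`. -/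
def IsFlatOn (T : Transport S Γ) (U : Set Y) (g : Y → Γ) : Prop :=
  ∀ {a b : S} (γ : Path a b), (∀ t, (γ t : Y) ∈ U) → T.toFun γ = g b * (g a)⁻¹

/-- An open set with a trivialization of a transport. -/
structure FlatSection (T : Transport S Γ) where
  /-- The open set. -/
  dom : Set Y
  isOpen : IsOpen dom
  /-- The trivialization. -/
  val : Y → Γ
  flat : T.IsFlatOn dom val

/-- Every point of the space has arbitrarily small open neighbourhoods whose intersection with `S`
is path connected and over which the transport is trivial. -/
def IsLocallyFlat (T : Transport S Γ) : Prop :=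
  ∀ y : Y, ∀ V ∈ 𝓝 y, ∃ U ⊆ V, IsOpen U ∧ y ∈ U ∧ IsPathConnected (U ∩ S) ∧
    ∃ g, T.IsFlatOn U g

theorem exists_path_of_isPathConnected {U : Set Y} (h : IsPathConnected (U ∩ S)) (a b : S)
    (ha : (a : Y) ∈ U) (hb : (b : Y) ∈ U) : ∃ γ : Path a b, ∀ t, (γ t : Y) ∈ U := by
  obtain ⟨γ, hγ⟩ := h.joinedIn a ⟨ha, a.2⟩ b ⟨hb, b.2⟩
  exact ⟨⟨⟨fun t => ⟨γ t, (hγ t).2⟩, by fun_prop⟩, Subtype.ext γ.source, Subtype.ext γ.target⟩,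
    fun t => (hγ t).1⟩

variable {T : Transport S Γ}

/-- Two trivializations differ, near each point, by a constant. -/
theorem IsLocallyFlat.eventually_const (hT : T.IsLocallyFlat) (i j : T.FlatSection) {x : Y}
    (hi : x ∈ i.dom) (hj : x ∈ j.dom) :
    ∃ c : Γ, ∀ᶠ x' in 𝓝 x, ∀ᶠ a in 𝓝[S] x', (j.val a)⁻¹ * i.val a = c := by
  obtain ⟨W, hWV, hWo, hxW, hWc, -⟩ := hT x _ ((i.isOpen.inter j.isOpen).mem_nhds ⟨hi, hj⟩)
  obtain ⟨a₀, ha₀W, ha₀S⟩ := hWc.nonempty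
  refine ⟨(j.val a₀)⁻¹ * i.val a₀, ?_⟩
  filter_upwards [hWo.mem_nhds hxW] with x' hx'
  filter_upwards [inter_mem_nhdsWithin S (hWo.mem_nhds hx')] with a ha
  obtain ⟨γ, hγ⟩ := exists_path_of_isPathConnected hWc ⟨a₀, ha₀S⟩ ⟨a, ha.1⟩ ha₀W ha.2
  have h1 := i.flat γ fun t => (hWV (hγ t)).1
  have h2 := j.flat γ fun t => (hWV (hγ t)).2
  rw [h1, mul_inv_eq_iff_eq_mul] at h2
  simp only at h2
  rw [h2]
  group

theorem IsLocallyFlat.neBot (hT : T.IsLocallyFlat) (x : Y) : (𝓝[S] x).NeBot := by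
  rw [← mem_closure_iff_nhdsWithin_neBot, mem_closure_iff_nhds]
  intro V hV
  obtain ⟨U, hUV, -, -, hc, -⟩ := hT x V hV
  exact hc.nonempty.mono (Set.inter_subset_inter_left _ hUV)

open Classical in
/-- The constant by which two trivializations differ near a point. -/
def FlatSection.change (i j : T.FlatSection) (x : Y) : Γ :=
  if h : ∃ c : Γ, ∀ᶠ a in 𝓝[S] x, (j.val a)⁻¹ * i.val a = c then h.choose else 1

theorem IsLocallyFlat.change_eq (hT : T.IsLocallyFlat) (i j : T.FlatSection) {x : Y} {c : Γ}
    (h : ∀ᶠ a in 𝓝[S] x, (j.val a)⁻¹ * i.val a = c) : i.change j x = c := by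
  have hex : ∃ c : Γ, ∀ᶠ a in 𝓝[S] x, (j.val a)⁻¹ * i.val a = c := ⟨c, h⟩
  have := hT.neBot x
  rw [FlatSection.change, dif_pos hex]
  obtain ⟨a, h1, h2⟩ := (hex.choose_spec.and h).exists
  exact h1.symm.trans h2

theorem IsLocallyFlat.eventually_change (hT : T.IsLocallyFlat) (i j : T.FlatSection) {x : Y}
    (hi : x ∈ i.dom) (hj : x ∈ j.dom) :
    ∀ᶠ a in 𝓝[S] x, (j.val a)⁻¹ * i.val a = i.change j x := by
  obtain ⟨c, hc⟩ := hT.eventually_const i j hi hj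
  rw [hT.change_eq i j hc.self_of_nhds]
  exact hc.self_of_nhds

theorem IsLocallyFlat.change_of_mem (hT : T.IsLocallyFlat) (i j : T.FlatSection) {x : Y}
    (hi : x ∈ i.dom) (hj : x ∈ j.dom) (hx : x ∈ S) :
    i.change j x = (j.val x)⁻¹ * i.val x :=
  ((hT.eventually_change i j hi hj).self_of_nhdsWithin hx).symm

/-- The bundle over the whole space glued from the trivializations. -/
def IsLocallyFlat.core [TopologicalSpace Γ] [DiscreteTopology Γ] (hT : T.IsLocallyFlat) :
    FiberBundleCore T.FlatSection Y Γ where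
  baseSet i := i.dom
  isOpen_baseSet i := i.isOpen
  indexAt x :=
    ⟨(hT x _ Filter.univ_mem).choose, (hT x _ Filter.univ_mem).choose_spec.2.1,
      (hT x _ Filter.univ_mem).choose_spec.2.2.2.2.choose,
      (hT x _ Filter.univ_mem).choose_spec.2.2.2.2.choose_spec⟩
  mem_baseSet_at x := (hT x _ Filter.univ_mem).choose_spec.2.2.1
  coordChange i j x v := i.change j x * v
  coordChange_self i x _ v := by
    rw [hT.change_eq i i (c := 1) (Filter.Eventually.of_forall fun a => inv_mul_cancel _), one_mul]
  continuousOn_coordChange i j := by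
    rintro ⟨x, v⟩ ⟨⟨hi, hj⟩, -⟩
    -- The same constant serves at all points near $x$, so the transition function is locally
    -- constant.
    refine ContinuousAt.continuousWithinAt ?_
    obtain ⟨c, hc⟩ := hT.eventually_const i j hi hj
    have h : (fun p : Y × Γ => c * p.2) =ᶠ[𝓝 (x, v)] fun p => i.change j p.1 * p.2 := by
      filter_upwards [continuousAt_fst.eventually hc] with p hp
      rw [hT.change_eq i j hp]
    exact ContinuousAt.congr
      ((continuous_of_discreteTopology (f := fun w : Γ => c * w)).comp
        continuous_snd).continuousAt h
  coordChange_comp i j k x hx v := by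
    have h1 := hT.eventually_change i j hx.1.1 hx.1.2
    have h2 := hT.eventually_change j k hx.1.2 hx.2
    rw [← mul_assoc, hT.change_eq i k (c := j.change k x * i.change j x)]
    filter_upwards [h1, h2] with a h1 h2
    rw [← h1, ← h2]
    group

/-- A locally flat transport on a subspace extends to the whole space. -/
theorem IsLocallyFlat.exists_extension (hT : T.IsLocallyFlat) :
    ∃ T' : Transport Y Γ, ∀ {a b : S} (γ : Path a b),
      T'.toFun (γ.map continuous_subtype_val) = T.toFun γ := by
  let : TopologicalSpace Γ := ⊥
  have : DiscreteTopology Γ := ⟨rfl⟩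
  let B := hT.core
  let mk : Y → Γ → B.TotalSpace := fun x v => ⟨x, v⟩
  let vec : B.TotalSpace → Γ := fun e => e.2
  -- Transition functions multiply on the left by $j^{-1}i$. Over `S`, the product of potential and
  -- coordinate is thus independent of the chart, and right multiplication acts on the bundle.
  let κ : B.TotalSpace → Γ := fun e => (B.indexAt e.1).val e.1 * vec e
  let R : Γ → B.TotalSpace → B.TotalSpace := fun c e => mk e.1 (vec e * c)
  obtain ⟨T', hT'⟩ := (FiberBundle.isCoveringMap (F := Γ) (E := B.Fiber)).exists_transport κ
    (fun y => ⟨mk y ((B.indexAt y).val y)⁻¹, rfl, mul_inv_cancel _⟩) R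
    (fun c => by
      refine continuous_iff_continuousAt.2 fun e => ?_
      rw [FiberBundle.continuousAt_totalSpace]
      refine ⟨(FiberBundle.continuous_proj Γ B.Fiber).continuousAt, ?_⟩
      have h1 := ((FiberBundle.continuousAt_totalSpace Γ (fun e : B.TotalSpace => e) (x₀ := e)).1
        continuousAt_id).2
      have h2 := (continuous_of_discreteTopology (f := fun w : Γ => w * c)).continuousAt.comp h1
      refine h2.congr (Filter.Eventually.of_forall fun e' => ?_)
      change (B.indexAt e'.1).change (B.indexAt e.1) e'.1 * vec e' * c =
        (B.indexAt e'.1).change (B.indexAt e.1) e'.1 * (vec e' * c)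
      exact mul_assoc _ _ _)
    (fun c e => rfl) (fun c e => (mul_assoc _ _ _).symm)
    (fun e e' h1 h2 => by
      obtain ⟨x, v⟩ := e
      obtain ⟨x', v'⟩ := e'
      obtain rfl : x = x' := h1
      exact congrArg (mk x) (mul_left_cancel (G := Γ) h2))
  refine ⟨T', fun {a b} γ => ?_⟩
  obtain ⟨P, hP⟩ := (T.comap (γ : C(I, S))).exists_potential
  have hP' : T.toFun γ = P 1 * (P 0)⁻¹ := by
    let ι : Path (0 : I) 1 := ⟨ContinuousMap.id I, rfl, rfl⟩
    exact (T.congr γ (ι.map (γ : C(I, S)).continuous) fun t => rfl).trans (hP ι)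
  -- The lift of $\gamma$ with $\kappa(L_s)=P_s$. In a fixed chart its coordinate is locally
  -- constant, because $P$ and the potential of the chart have the same increments along $\gamma$.
  let L : I → B.TotalSpace := fun s =>
    mk (γ s) (((B.indexAt (γ s : Y)).val (γ s))⁻¹ * P s)
  have hL : Continuous L := by
    refine continuous_iff_continuousAt.2 fun s₀ => ?_
    rw [FiberBundle.continuousAt_totalSpace]
    have hγ : Continuous fun s => (γ s : Y) := by fun_prop
    refine ⟨hγ.continuousAt, ?_⟩
    set i := B.indexAt (γ s₀ : Y) with hi
    have hmem : (γ s₀ : Y) ∈ i.dom := B.mem_baseSet_at _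
    obtain ⟨J, ⟨hJ, hJc⟩, hJi⟩ := (path_connected_basis s₀).mem_iff.1
      (hγ.continuousAt.preimage_mem_nhds (i.isOpen.mem_nhds hmem))
    have hloc : ∀ s ∈ J, (i.val (γ s))⁻¹ * P s = (i.val (γ s₀))⁻¹ * P s₀ := by
      intro s hs
      obtain ⟨δ, hδ⟩ := hJc.joinedIn s₀ (mem_of_mem_nhds hJ) s hs
      have h1 := hP δ
      have h2 := i.flat (δ.map γ.continuous) fun t => hJi (hδ t)
      have h3 : P s * (P s₀)⁻¹ = i.val (γ s) * (i.val (γ s₀))⁻¹ := h1.symm.trans h2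
      rw [mul_inv_eq_iff_eq_mul] at h3
      rw [h3]
      group
    refine (continuousAt_const (y := (i.val (γ s₀))⁻¹ * P s₀)).congr ?_
    filter_upwards [hJ] with s hs
    rw [← hloc s hs]
    have h1 : (B.indexAt (γ s : Y)).change i (γ s) =
        (i.val (γ s))⁻¹ * (B.indexAt (γ s : Y)).val (γ s) :=
      hT.change_of_mem _ _ (B.mem_baseSet_at _) (hJi hs) (γ s).2
    change _ = (B.indexAt (γ s : Y)).change i (γ s) *
      (((B.indexAt (γ s : Y)).val (γ s))⁻¹ * P s)
    rw [h1]
    group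
  rw [hT' (γ.map continuous_subtype_val) ⟨L, hL⟩ (fun t => rfl), hP']
  change (B.indexAt (γ 1 : Y)).val (γ 1) * (((B.indexAt (γ 1 : Y)).val (γ 1))⁻¹ * P 1) *
    ((B.indexAt (γ 0 : Y)).val (γ 0) * (((B.indexAt (γ 0 : Y)).val (γ 0))⁻¹ * P 0))⁻¹ = _
  group

end Transport

/-! ### Holonomy of meridians in flat charts. -/

/-- Paths in the punctured plane have continuous logarithms. -/
theorem exists_continuous_log (z : I → ℂ) (hz : Continuous z) (h0 : ∀ t, z t ≠ 0) :
    ∃ w : I → ℂ, Continuous w ∧ ∀ t, Complex.exp (w t) = z t := by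
  obtain ⟨w, ⟨-, hw⟩, -⟩ := Complex.isCoveringMapOn_exp.existsUnique_continuousMap_lifts
    (⟨z, hz⟩ : C(I, ℂ)) (a₀ := 0) (Complex.exp_log (h0 0)) (fun t => h0 t)
  exact ⟨w, w.continuous, fun t => congrFun hw t⟩

namespace FlatChart

variable {K : Set S3} (e : FlatChart K)

theorem continuous_symm : Continuous e.chart.symm := by
  have := e.chart.continuousOn_symm
  rwa [e.target_eq, continuousOn_univ] at this

theorem chart_symm_apply (v : ℂ × ℝ) : e.chart (e.chart.symm v) = v :=
  e.chart.right_inv (by rw [e.target_eq]; trivial)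

theorem symm_mem_source (v : ℂ × ℝ) : e.chart.symm v ∈ e.chart.source :=
  e.chart.map_target (by rw [e.target_eq]; trivial)

theorem symm_mem_iff (v : ℂ × ℝ) : e.chart.symm v ∈ K ↔ v.1 = 0 := by
  rw [e.mem_iff _ (e.symm_mem_source v), e.chart_symm_apply]

/-- The universal covering of the complement of the axis, as a map to the knot complement. -/
def param : C(ℂ × ℝ, (Kᶜ : Set S3)) where
  toFun v := ⟨e.chart.symm (Complex.exp v.1, v.2), fun h =>
    Complex.exp_ne_zero _ ((e.symm_mem_iff _).1 h)⟩
  continuous_toFun := Continuous.subtype_mk (e.continuous_symm.comp (by fun_prop)) _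

theorem range_param : (fun v => (e.param v : S3)) '' Set.univ = e.chart.source \ K := by
  ext x
  constructor
  · rintro ⟨v, -, rfl⟩
    exact ⟨e.symm_mem_source _, (e.param v).2⟩
  · rintro ⟨hx, hxK⟩
    rw [e.mem_iff x hx] at hxK
    refine ⟨(Complex.log (e.chart x).1, (e.chart x).2), trivial, ?_⟩
    change e.chart.symm (Complex.exp _, _) = x
    rw [Complex.exp_log hxK]
    exact e.chart.left_inv hx

theorem isPathConnected_source_diff : IsPathConnected (e.chart.source \ K) := by
  rw [← e.range_param]
  exact isPathConnected_univ.image (continuous_subtype_val.comp e.param.continuous)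

theorem exp_add_int_mul (w : ℂ) (n : ℤ) :
    Complex.exp (w + n * (2 * Real.pi * Complex.I)) = Complex.exp w :=
  Complex.exp_periodic.int_mul n w

variable {Γ : Type*} [Group Γ]

/-- Near the knot a transport of the complement is determined by a function of logarithmic
coordinates and the holonomy of the meridian. -/
theorem exists_potential (T : Transport (Kᶜ : Set S3) Γ) :
    ∃ (g : ℂ × ℝ → Γ) (N : Γ),
      (∀ {a b : ℂ × ℝ} (γ : Path a b),
        T.toFun (γ.map e.param.continuous) = g b * (g a)⁻¹) ∧
      ∀ (w : ℂ) (t : ℝ) (n : ℤ), g (w + n * (2 * Real.pi * Complex.I), t) = g (w, t) * N ^ n := by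
  obtain ⟨g, hg⟩ := (T.comap e.param).exists_potential
  -- A path and its translate by $2\pi i$ have the same image in the complement, hence equal
  -- transports; the jump of $g$ does not depend on the point.
  have hshift : ∀ (a b : ℂ × ℝ),
      (g a)⁻¹ * g (a.1 + 2 * Real.pi * Complex.I, a.2) =
        (g b)⁻¹ * g (b.1 + 2 * Real.pi * Complex.I, b.2) := by
    intro a b
    let γ := PathConnectedSpace.somePath a b
    let τ : C(ℂ × ℝ, ℂ × ℝ) := ⟨fun v => (v.1 + 2 * Real.pi * Complex.I, v.2), by fun_prop⟩
    have h1 := hg γ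
    have h2 := hg (γ.map τ.continuous)
    have h3 : (T.comap e.param).toFun γ = (T.comap e.param).toFun (γ.map τ.continuous) := by
      refine T.congr _ _ fun t => Subtype.ext ?_
      change e.chart.symm (Complex.exp (γ t).1, (γ t).2) =
        e.chart.symm (Complex.exp ((γ t).1 + 2 * Real.pi * Complex.I), (γ t).2)
      rw [Complex.exp_periodic]
    rw [h3, h2] at h1
    change g (b.1 + 2 * Real.pi * Complex.I, b.2) * (g (a.1 + 2 * Real.pi * Complex.I, a.2))⁻¹ =
      g b * (g a)⁻¹ at h1
    rw [mul_inv_eq_iff_eq_mul] at h1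
    rw [h1]
    group
  refine ⟨g, (g (0, 0))⁻¹ * g ((0 : ℂ × ℝ).1 + 2 * Real.pi * Complex.I, (0 : ℂ × ℝ).2),
    fun γ => hg γ, fun w t n => ?_⟩
  have hN : ∀ (w : ℂ), g (w + 2 * Real.pi * Complex.I, t) = g (w, t) * ((g (0, 0))⁻¹ *
      g ((0 : ℂ × ℝ).1 + 2 * Real.pi * Complex.I, (0 : ℂ × ℝ).2)) := by
    intro w
    have := hshift (w, t) 0
    rw [inv_mul_eq_iff_eq_mul] at this
    exact this
  generalize (g (0, 0))⁻¹ * g ((0 : ℂ × ℝ).1 + 2 * Real.pi * Complex.I, (0 : ℂ × ℝ).2) = N at hN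
  induction n using Int.induction_on with
  | zero => simp
  | succ k ih =>
    have := hN (w + k * (2 * Real.pi * Complex.I))
    push_cast at ih ⊢
    rw [add_mul, one_mul, ← add_assoc, this, ih, mul_assoc, _root_.zpow_add_one]
  | pred k ih =>
    have := hN (w + (-k - 1) * (2 * Real.pi * Complex.I))
    push_cast at ih ⊢
    rw [show w + (-k - 1) * (2 * Real.pi * Complex.I) + 2 * Real.pi * Complex.I =
      w + -k * (2 * Real.pi * Complex.I) by ring, ih] at this
    rw [_root_.zpow_sub_one, ← mul_assoc (g (w, t)), this, mul_inv_cancel_right]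

/-- The path in logarithmic coordinates that goes once around the axis. -/
def logCircle (a : ℂ × ℝ) : Path a (a.1 + (1 : ℤ) * (2 * Real.pi * Complex.I), a.2) where
  toFun u := (a.1 + (u : ℝ) * (2 * Real.pi * Complex.I), a.2)
  continuous_toFun := by fun_prop
  source' := by simp
  target' := by simp

theorem toFun_logCircle {T : Transport (Kᶜ : Set S3) Γ} {g : ℂ × ℝ → Γ} {N : Γ}
    (hg : ∀ {a b : ℂ × ℝ} (γ : Path a b), T.toFun (γ.map e.param.continuous) = g b * (g a)⁻¹)
    (hN : ∀ (w : ℂ) (t : ℝ) (n : ℤ),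
      g (w + n * (2 * Real.pi * Complex.I), t) = g (w, t) * N ^ n) (a : ℂ × ℝ) :
    T.toFun ((logCircle a).map e.param.continuous) = g a * N * (g a)⁻¹ := by
  rw [hg, hN, zpow_one]

theorem toFun_circleLoop {T : Transport (Kᶜ : Set S3) Γ} {g : ℂ × ℝ → Γ} {N : Γ}
    (hg : ∀ {a b : ℂ × ℝ} (γ : Path a b), T.toFun (γ.map e.param.continuous) = g b * (g a)⁻¹)
    (hN : ∀ (w : ℂ) (t : ℝ) (n : ℤ),
      g (w + n * (2 * Real.pi * Complex.I), t) = g (w, t) * N ^ n) :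
    T.toFun e.circleLoop = g 0 * N * (g 0)⁻¹ := by
  rw [← e.toFun_logCircle hg hN]
  refine T.congr _ _ fun u => Subtype.ext ?_
  change e.chart.symm (((Circle.exp (2 * Real.pi * u) : Circle) : ℂ), 0) =
    e.chart.symm (Complex.exp (0 + (u : ℝ) * (2 * Real.pi * Complex.I)), 0)
  rw [Circle.coe_exp]
  congr 3
  push_cast
  ring

/-- If two flat charts meet at a point of the knot, the holonomy around the circle of the first
is conjugate to a power of the holonomy around the circle of the second. -/
theorem exists_conj_zpow (T : Transport (Kᶜ : Set S3) Γ) (e' : FlatChart K) {x : S3} (hxK : x ∈ K)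
    (hx : x ∈ e.chart.source) (hx' : x ∈ e'.chart.source) :
    ∃ (n : ℤ) (c : Γ), T.toFun e.circleLoop = c * T.toFun e'.circleLoop ^ n * c⁻¹ := by
  obtain ⟨g, N, hg, hN⟩ := e.exists_potential T
  obtain ⟨g', N', hg', hN'⟩ := e'.exists_potential T
  set t₀ := (e.chart x).2
  have hex : e.chart.symm ((0 : ℂ), t₀) = x := by
    have h0 : (e.chart x).1 = 0 := (e.mem_iff x hx).1 hxK
    rw [← h0]
    exact e.chart.left_inv hx
  have hnhds : (fun z : ℂ => e.chart.symm (z, t₀)) ⁻¹' e'.chart.source ∈ 𝓝 (0 : ℂ) := by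
    refine ContinuousAt.preimage_mem_nhds ?_ ?_
    · exact (e.continuous_symm.comp (by fun_prop)).continuousAt
    · rw [hex]
      exact e'.chart.open_source.mem_nhds hx'
  obtain ⟨r, hr, hball⟩ := Metric.nhds_basis_closedBall.mem_iff.1 hnhds
  -- The circle of radius $r$ at height $t_0$ in the first chart lies inside the second. Its
  -- logarithm there closes up to $2\pi i n$; the value of $n$ is not needed.
  let a : ℂ × ℝ := ((Real.log r : ℝ), t₀)
  let η := (logCircle a).map e.param.continuous
  have hη : ∀ u, (η u : S3) ∈ e'.chart.source := by
    intro u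
    refine hball (a := Complex.exp ((Real.log r : ℝ) + (u : ℝ) * (2 * Real.pi * Complex.I))) ?_
    rw [mem_closedBall_zero_iff, Complex.norm_exp]
    simp [Real.exp_log hr]
  have hηc : Continuous fun u => e'.chart (η u : S3) :=
    e'.chart.continuousOn.comp_continuous (by fun_prop) hη
  obtain ⟨w, hw, hwz⟩ := exists_continuous_log (fun u => (e'.chart (η u : S3)).1)
    hηc.fst fun u h => (η u).2 ((e'.mem_iff _ (hη u)).2 h)
  let δ : Path (w 0, (e'.chart (η 0 : S3)).2) (w 1, (e'.chart (η 1 : S3)).2) :=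
    { toFun := fun u => (w u, (e'.chart (η u : S3)).2)
      continuous_toFun := hw.prodMk hηc.snd
      source' := rfl
      target' := rfl }
  have hδ : T.toFun η = T.toFun (δ.map e'.param.continuous) := by
    refine T.congr _ _ fun u => Subtype.ext ?_
    change (η u : S3) = e'.chart.symm (Complex.exp (w u), (e'.chart (η u : S3)).2)
    rw [hwz]
    exact (e'.chart.left_inv (hη u)).symm
  have hends : (η 1 : S3) = η 0 := by
    change e.chart.symm (Complex.exp (a.1 + ((1 : I) : ℝ) * (2 * Real.pi * Complex.I)), t₀) =
      e.chart.symm (Complex.exp (a.1 + ((0 : I) : ℝ) * (2 * Real.pi * Complex.I)), t₀)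
    have := exp_add_int_mul a.1 1
    simp at this ⊢
    rw [this]
  obtain ⟨n, hn⟩ := Complex.exp_eq_exp_iff_exists_int.1
    ((hwz 1).trans ((congrArg (fun y => (e'.chart y).1) hends).trans (hwz 0).symm))
  rw [hg', hends, hn, hN', e.toFun_logCircle hg hN] at hδ
  refine ⟨n, g 0 * (g a)⁻¹ * g' (w 0, (e'.chart (η 0 : S3)).2) * (g' 0)⁻¹, ?_⟩
  rw [e.toFun_circleLoop hg hN, e'.toFun_circleLoop hg' hN', conj_zpow]
  have hN2 : N = (g a)⁻¹ * (g' (w 0, (e'.chart (η 0 : S3)).2) * N' ^ n *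
      (g' (w 0, (e'.chart (η 0 : S3)).2))⁻¹) * g a := by
    rw [← hδ]; group
  rw [hN2]
  group

theorem circleLoop_sq_eq_one (T : Transport (Kᶜ : Set S3) Γ) (e' : FlatChart K) {x : S3}
    (hxK : x ∈ K) (hx : x ∈ e.chart.source) (hx' : x ∈ e'.chart.source)
    (h : T.toFun e'.circleLoop ^ 2 = 1) : T.toFun e.circleLoop ^ 2 = 1 := by
  obtain ⟨n, c, hc⟩ := e.exists_conj_zpow T e' hxK hx hx'
  rw [hc, conj_pow, ← zpow_natCast, ← _root_.zpow_mul, mul_comm, _root_.zpow_mul,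
    zpow_natCast, h, _root_.one_zpow, mul_one, mul_inv_cancel]

end FlatChart

namespace IsKnot

variable {K : Set S3} {Γ : Type*} [Group Γ]

theorem isClosed (hK : IsKnot K) : IsClosed K := by
  obtain ⟨φ⟩ := hK.circle
  have : CompactSpace K := φ.symm.compactSpace
  exact (isCompact_iff_compactSpace.2 this).isClosed

/-- The condition that the holonomy of the meridian has order at most two propagates along the
knot. -/
theorem circleLoop_sq_eq_one (hK : IsKnot K) (T : Transport (Kᶜ : Set S3) Γ)
    (e₁ e₂ : FlatChart K) (h : T.toFun e₁.circleLoop ^ 2 = 1) : T.toFun e₂.circleLoop ^ 2 = 1 := by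
  obtain ⟨φ⟩ := hK.circle
  have : PathConnectedSpace K := φ.symm.surjective.pathConnectedSpace φ.symm.continuous
  -- By the comparison of charts, testing one chart at $x$ is the same as testing all, which makes
  -- `P` locally constant on the connected $K$.
  let P : K → Prop := fun x => ∀ e : FlatChart K, (x : S3) ∈ e.chart.source →
    T.toFun e.circleLoop ^ 2 = 1
  have hP : ∀ (e : FlatChart K) (x : K), (x : S3) ∈ e.chart.source →
      (P x ↔ T.toFun e.circleLoop ^ 2 = 1) := fun e x hx =>
    ⟨fun h => h e hx, fun h e' hx' => e'.circleLoop_sq_eq_one T e x.2 hx' hx h⟩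
  have hloc : IsLocallyConstant P := by
    rw [IsLocallyConstant.iff_eventually_eq]
    intro x
    obtain ⟨e, hx⟩ := hK.locallyFlat x x.2
    filter_upwards [(e.chart.open_source.preimage continuous_subtype_val).mem_nhds hx] with y hy
    exact propext ((hP e y hy).trans (hP e x hx).symm)
  let x : FlatChart K → K := fun e => ⟨e.chart.symm (0, 0), (e.symm_mem_iff _).2 rfl⟩
  rw [← hP e₁ (x e₁) (e₁.symm_mem_source _)] at h
  rw [← hP e₂ (x e₂) (e₂.symm_mem_source _)]
  exact (hloc.apply_eq_of_preconnectedSpace (x e₁) (x e₂)).mp h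

end IsKnot

/-! ### Path connectedness of the knot complement. -/

instance : Fact (Module.finrank ℝ (EuclideanSpace ℝ (Fin 4)) = 3 + 1) := ⟨by simp⟩

instance : PreconnectedSpace S3 := by
  refine isPreconnected_iff_preconnectedSpace.1 (isConnected_sphere ?_ 0 zero_le_one).isPreconnected
  rw [← Module.finrank_eq_rank]
  simp

instance : LocallyPathConnectedSpace S3 :=
  ChartedSpace.locallyPathConnectedSpace (EuclideanSpace ℝ (Fin 3)) S3

namespace IsKnot

variable {K : Set S3}

theorem neBot_nhdsWithin_compl (hK : IsKnot K) (x : S3) : (𝓝[Kᶜ] x).NeBot := by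
  by_cases hx : x ∈ K
  · obtain ⟨e, hxe⟩ := hK.locallyFlat x hx
    have h0 : e.chart.symm ((0 : ℂ), (e.chart x).2) = x := by
      rw [← (e.mem_iff x hxe).1 hx]
      exact e.chart.left_inv hxe
    have ht : Filter.Tendsto (fun z : ℂ => e.chart.symm (z, (e.chart x).2)) (𝓝[≠] 0)
        (𝓝[Kᶜ] x) := by
      refine tendsto_nhdsWithin_iff.2 ⟨?_, ?_⟩
      · have h : Continuous fun z : ℂ => e.chart.symm (z, (e.chart x).2) :=
          e.continuous_symm.comp (by fun_prop)
        have := h.tendsto 0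
        rw [h0] at this
        exact this.mono_left nhdsWithin_le_nhds
      · filter_upwards [self_mem_nhdsWithin] with z hz
        exact fun h => hz ((e.symm_mem_iff _).1 h)
    exact ht.neBot
  · rw [hK.isClosed.isOpen_compl.nhdsWithin_eq hx]
    infer_instance

/-- Every point of the sphere has a neighbourhood that meets the knot complement in a path
connected set. -/
theorem exists_nhds_isPathConnected_diff (hK : IsKnot K) (x : S3) :
    ∃ U ∈ 𝓝 x, IsPathConnected (U \ K) := by
  by_cases hx : x ∈ K
  · obtain ⟨e, hxe⟩ := hK.locallyFlat x hx
    exact ⟨_, e.chart.open_source.mem_nhds hxe, e.isPathConnected_source_diff⟩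
  · obtain ⟨U, ⟨hU, hUc⟩, hUK⟩ := (path_connected_basis x).mem_iff.1
      (hK.isClosed.isOpen_compl.mem_nhds hx)
    refine ⟨U, hU, ?_⟩
    rwa [show U \ K = U from Set.Subset.antisymm Set.sdiff_subset fun a h => ⟨h, hUK h⟩]

/-- The complement of a knot is path connected. -/
theorem pathConnectedSpace_compl (hK : IsKnot K) (x₀ : (Kᶜ : Set S3)) :
    PathConnectedSpace (Kᶜ : Set S3) := by
  -- Both conditions concern only nearby points of the complement, so they apply on $K$ too and
  -- split the connected sphere into two open sets. Density of the complement makes them disjoint.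
  let A : Set S3 := {x | ∀ᶠ x' in 𝓝 x, x' ∈ Kᶜ → JoinedIn Kᶜ x₀ x'}
  let B : Set S3 := {x | ∀ᶠ x' in 𝓝 x, x' ∈ Kᶜ → ¬ JoinedIn Kᶜ x₀ x'}
  have hAo : IsOpen A := isOpen_iff_mem_nhds.2 fun x hx => eventually_eventually_nhds.2 hx
  have hBo : IsOpen B := isOpen_iff_mem_nhds.2 fun x hx => eventually_eventually_nhds.2 hx
  have hAB : Disjoint A B := by
    rw [Set.disjoint_left]
    intro x hA hB
    have := hK.neBot_nhdsWithin_compl x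
    obtain ⟨x', h1, h2⟩ := ((eventually_nhdsWithin_iff.2 hA).and
      (eventually_nhdsWithin_iff.2 hB)).exists
    exact h2 h1
  have hABu : A ∪ B = Set.univ := by
    refine Set.eq_univ_of_forall fun x => ?_
    obtain ⟨U, hU, hUc⟩ := hK.exists_nhds_isPathConnected_diff x
    obtain ⟨a, ha⟩ := hUc.nonempty
    have hja : ∀ x' ∈ U, x' ∈ Kᶜ → JoinedIn Kᶜ a x' := fun x' h h' =>
      (hUc.joinedIn a ha x' ⟨h, h'⟩).mono fun _ h => h.2
    by_cases h : JoinedIn Kᶜ x₀ a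
    · left
      filter_upwards [hU] with x' hx' hx'K
      exact h.trans (hja x' hx' hx'K)
    · right
      filter_upwards [hU] with x' hx' hx'K h'
      exact h (h'.trans (hja x' hx' hx'K).symm)
  have hAc : IsClopen A := by
    refine ⟨⟨?_⟩, hAo⟩
    rwa [IsCompl.compl_eq ⟨hAB, codisjoint_iff.2 hABu⟩]
  have hx₀A : (x₀ : S3) ∈ A := by
    rcases (hABu.symm ▸ Set.mem_univ (x₀ : S3) : (x₀ : S3) ∈ A ∪ B) with h | h
    · exact h
    · exact absurd (JoinedIn.refl x₀.2) (h.self_of_nhds x₀.2)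
  have hA : A = Set.univ := hAc.eq_univ ⟨_, hx₀A⟩
  rw [← isPathConnected_iff_pathConnectedSpace]
  refine ⟨x₀, x₀.2, fun {x} hx => ?_⟩
  have : x ∈ A := hA ▸ Set.mem_univ x
  exact this.self_of_nhds hx

end IsKnot

/-! ### Local flatness on the branched double cover. -/

namespace Transport

variable {Y Γ : Type*} [TopologicalSpace Y] [Group Γ] {S : Set Y}

/-- A transport is locally trivial near a point with a Euclidean chart. -/
theorem exists_isFlatOn_of_chart {E : Type*} [NormedAddCommGroup E] [InnerProductSpace ℝ E]
    (T : Transport S Γ) (hS : IsOpen S) (φ : OpenPartialHomeomorph S E) (s : S)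
    (hs : s ∈ φ.source) {V : Set Y} (hV : V ∈ 𝓝 (s : Y)) :
    ∃ U ⊆ V, IsOpen U ∧ (s : Y) ∈ U ∧ IsPathConnected (U ∩ S) ∧ ∃ g, T.IsFlatOn U g := by
  classical
  have hnhds : φ.target ∩ φ.symm ⁻¹' (Subtype.val ⁻¹' V) ∈ 𝓝 (φ s) := by
    refine Filter.inter_mem (φ.open_target.mem_nhds (φ.map_source hs)) ?_
    refine (φ.continuousAt_symm (φ.map_source hs)).preimage_mem_nhds ?_
    rw [φ.left_inv hs]
    exact continuous_subtype_val.continuousAt.preimage_mem_nhds hV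
  obtain ⟨r, hr, hball⟩ := Metric.nhds_basis_ball.mem_iff.1 hnhds
  -- Rescaling a small ball to all of `E` parametrizes the neighbourhood by a simply connected
  -- space, on which a potential exists.
  let β : OpenPartialHomeomorph E E := OpenPartialHomeomorph.univBall (φ s) r
  have hβt : β.target = Metric.ball (φ s) r := OpenPartialHomeomorph.univBall_target _ hr
  have hβs : β.source = Set.univ := OpenPartialHomeomorph.univBall_source _ _
  have hβ : ∀ v : E, β v ∈ Metric.ball (φ s) r := fun v => by
    rw [← hβt]
    exact β.map_source (by rw [hβs]; trivial)
  let Q : C(E, S) := ⟨fun v : E => φ.symm (β v), φ.continuousOn_symm.comp_continuous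
    (OpenPartialHomeomorph.continuous_univBall (φ s) r) fun v : E => (hball (hβ v)).1⟩
  let W : Set S := φ.source ∩ φ ⁻¹' Metric.ball (φ s) r
  have hWQ : ∀ w ∈ W, Q (β.symm (φ w)) = w := fun w hw => by
    change φ.symm (β (β.symm (φ w))) = w
    rw [β.right_inv (hβt ▸ hw.2), φ.left_inv hw.1]
  have hW : W = Q '' Set.univ := by
    ext w
    constructor
    · exact fun hw => ⟨_, trivial, hWQ w hw⟩
    · rintro ⟨v, -, rfl⟩
      refine ⟨φ.map_target (hball (hβ v)).1, ?_⟩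
      change φ (φ.symm (β v)) ∈ Metric.ball (φ s) r
      rw [φ.right_inv (hball (hβ v)).1]
      exact hβ v
  obtain ⟨g, hg⟩ := (T.comap Q).exists_potential
  refine ⟨Subtype.val '' W, ?_, ?_, ⟨s, ⟨hs, Metric.mem_ball_self hr⟩, rfl⟩, ?_,
    fun y => if h : y ∈ S then g (β.symm (φ ⟨y, h⟩)) else 1, ?_⟩
  · rw [hW]
    rintro _ ⟨_, ⟨v, -, rfl⟩, rfl⟩
    exact (hball (hβ v)).2
  · exact hS.isOpenMap_subtype_val _ (φ.isOpen_inter_preimage Metric.isOpen_ball)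
  · rw [Set.inter_eq_left.2 (by rintro _ ⟨w, -, rfl⟩; exact w.2), hW]
    exact (isPathConnected_univ.image Q.continuous).image continuous_subtype_val
  · intro a b γ hγ
    have hγW : ∀ t, γ t ∈ W := fun t => by
      obtain ⟨w, hw, h⟩ := hγ t
      rwa [← Subtype.ext h]
    let δ : Path (β.symm (φ a)) (β.symm (φ b)) :=
      { toFun := fun t => β.symm (φ (γ t))
        continuous_toFun := β.continuousOn_symm.comp_continuous
          (φ.continuousOn.comp_continuous γ.continuous fun t => (hγW t).1)
          fun t => hβt ▸ (hγW t).2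
        source' := by simp
        target' := by simp }
    have h1 : T.toFun γ = (T.comap Q).toFun δ := T.congr _ _ fun t => (hWQ _ (hγW t)).symm
    rw [h1, hg]
    simp

end Transport

namespace IsBranchedDoubleCover

variable {Y : Type*} [TopologicalSpace Y] {p : Y → S3} {K : Set S3}

/-- The unbranched part of the covering. -/
def projCompl (hp : IsBranchedDoubleCover p K) : C(p ⁻¹' Kᶜ, (Kᶜ : Set S3)) :=
  ⟨Kᶜ.restrictPreimage p, hp.continuous.restrictPreimage⟩

theorem isCoveringMap_projCompl (hp : IsBranchedDoubleCover p K) : IsCoveringMap hp.projCompl :=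
  hp.covering.isCoveringMap_restrictPreimage

theorem exists_chart (hp : IsBranchedDoubleCover p K) (hK : IsKnot K) (s : p ⁻¹' Kᶜ) :
    ∃ φ : OpenPartialHomeomorph (p ⁻¹' Kᶜ) (EuclideanSpace ℝ (Fin 3)), s ∈ φ.source := by
  obtain ⟨ψ, hs, hψ⟩ := hp.isCoveringMap_projCompl.isLocalHomeomorph s
  have : Nonempty (Kᶜ : Set S3) := ⟨hp.projCompl s⟩
  let ι : OpenPartialHomeomorph (Kᶜ : Set S3) S3 :=
    hK.isClosed.isOpen_compl.isOpenEmbedding_subtypeVal.toOpenPartialHomeomorph _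
  refine ⟨(ψ.trans ι).trans (chartAt (EuclideanSpace ℝ (Fin 3)) (p s)), ?_⟩
  simp only [OpenPartialHomeomorph.trans_source, Set.mem_inter_iff, Set.mem_preimage]
  refine ⟨⟨hs, trivial⟩, ?_⟩
  have : (ψ.trans ι) s = p s := by
    change ((ψ s : (Kᶜ : Set S3)) : S3) = p s
    rw [← hψ]
    rfl
  rw [this]
  exact mem_chart_source _ _

variable {Γ : Type*} [Group Γ]

/-- If the holonomies of meridians have order at most two, the pull back of a transport to the
branched double cover is trivial near the branch set. -/
theorem exists_isFlatOn_of_mem (hp : IsBranchedDoubleCover p K) (T : Transport (Kᶜ : Set S3) Γ)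
    (hT : ∀ e : FlatChart K, T.toFun e.circleLoop ^ 2 = 1) {y : Y} (hy : p y ∈ K) {V : Set Y}
    (hV : V ∈ 𝓝 y) :
    ∃ U ⊆ V, IsOpen U ∧ y ∈ U ∧ IsPathConnected (U ∩ p ⁻¹' Kᶜ) ∧
      ∃ g, (T.comap hp.projCompl).IsFlatOn U g := by
  obtain ⟨e, f, hye, hfs, hft, hf⟩ := hp.branched _ hy
  have hyf : y ∈ f.source := hfs ▸ hye
  have hfc : Continuous f.symm := by
    have := f.continuousOn_symm
    rwa [hft, continuousOn_univ] at this
  have hff : ∀ v, f (f.symm v) = v := fun v => f.right_inv (hft ▸ Set.mem_univ v)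
  have hfm : ∀ v, f.symm v ∈ f.source := fun v => f.map_target (hft ▸ Set.mem_univ v)
  have hmem : ∀ y' ∈ f.source, p y' ∈ K ↔ (f y').1 = 0 := fun y' hy' => by
    rw [e.mem_iff _ (by rw [hfs] at hy'; exact hy'), hf y' hy', sq_eq_zero_iff]
  obtain ⟨g, N, hg, hN⟩ := e.exists_potential T
  have hN2 : N ^ 2 = 1 := by
    have := hT e
    rwa [e.toFun_circleLoop hg hN, conj_pow, conj_eq_one_iff] at this
  have hnhds : f.symm ⁻¹' V ∈ 𝓝 (f y) :=
    hfc.continuousAt.preimage_mem_nhds (by rwa [f.left_inv hyf])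
  obtain ⟨r, hr, hball⟩ := Metric.nhds_basis_ball.mem_iff.1 hnhds
  have hfy : f y = (0, (f y).2) := Prod.ext ((hmem y hyf).1 hy) rfl
  -- Since $p$ is $(z,t)\mapsto(z^2,t)$, the logarithmic coordinate downstairs is $2\log z$.
  refine ⟨f.source ∩ f ⁻¹' Metric.ball (f y) r, ?_, f.isOpen_inter_preimage Metric.isOpen_ball,
    ⟨hyf, Metric.mem_ball_self hr⟩, ?_, fun y' => g (2 * Complex.log (f y').1, (f y').2), ?_⟩
  · rintro y' ⟨h1, h2⟩
    have := hball h2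
    rwa [Set.mem_preimage, f.left_inv h1] at this
  · have himage : f.source ∩ f ⁻¹' Metric.ball (f y) r ∩ p ⁻¹' Kᶜ =
        (fun v : ℂ × ℝ => f.symm (Complex.exp v.1, v.2)) ''
          ({w : ℂ | w.re < Real.log r} ×ˢ Metric.ball (f y).2 r) := by
      have hexp : ∀ w : ℂ, Complex.exp w ∈ Metric.ball (0 : ℂ) r ↔ w.re < Real.log r := fun w => by
        rw [mem_ball_zero_iff, Complex.norm_exp, Real.lt_log_iff_exp_lt hr]
      rw [hfy, ← ball_prod_same]
      ext y'
      constructor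
      · rintro ⟨⟨h1, h2, h3⟩, h4⟩
        have h0 : (f y').1 ≠ 0 := fun h => h4 ((hmem y' h1).2 h)
        refine ⟨(Complex.log (f y').1, (f y').2), ⟨?_, h3⟩, ?_⟩
        · refine (hexp _).1 ?_
          rwa [Complex.exp_log h0]
        · simp only [Complex.exp_log h0]
          exact f.left_inv h1
      · rintro ⟨v, ⟨h1, h2⟩, rfl⟩
        refine ⟨⟨hfm _, ?_⟩, fun h => ?_⟩
        · rw [Set.mem_preimage, hff]
          exact ⟨(hexp _).2 h1, h2⟩
        · have := (hmem _ (hfm _)).1 h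
          rw [hff] at this
          exact Complex.exp_ne_zero _ this
    rw [himage]
    refine IsPathConnected.image ?_ (hfc.comp (by fun_prop))
    refine Convex.isPathConnected ?_ ⟨((Real.log r - 1 : ℝ), (f y).2), ?_,
      Metric.mem_ball_self hr⟩
    · exact (convex_halfSpace_re_lt _).prod (convex_ball _ _)
    · simp
  · intro a b γ hγ
    have hne : ∀ t, (f (γ t)).1 ≠ 0 := fun t h => (γ t).2 ((hmem _ (hγ t).1).2 h)
    have hfγ : Continuous fun t => f (γ t : Y) :=
      f.continuousOn.comp_continuous (by fun_prop) fun t => (hγ t).1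
    obtain ⟨w, hw, hwz⟩ := exists_continuous_log (fun t => (f (γ t)).1) hfγ.fst hne
    let δ : Path (2 * w 0, (f (γ 0)).2) (2 * w 1, (f (γ 1)).2) :=
      { toFun := fun t => (2 * w t, (f (γ t)).2)
        continuous_toFun := (continuous_const.mul hw).prodMk hfγ.snd
        source' := rfl
        target' := rfl }
    have h1 : (T.comap hp.projCompl).toFun γ = T.toFun (δ.map e.param.continuous) := by
      refine T.congr _ _ fun t => Subtype.ext ?_
      change p (γ t) = e.chart.symm (Complex.exp (2 * w t), (f (γ t)).2)
      rw [two_mul, Complex.exp_add, ← sq, hwz, ← hf _ (hγ t).1]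
      refine (e.chart.left_inv ?_).symm
      have := (hγ t).1
      rwa [hfs] at this
    -- Changing the branch of $\log z$ by $2\pi i n$ multiplies $g$ by $N^{2n}=1$, so the
    -- discontinuous principal branch does no harm.
    have h2 : ∀ t, g (2 * w t, (f (γ t)).2) =
        g (2 * Complex.log (f (γ t)).1, (f (γ t)).2) := by
      intro t
      obtain ⟨n, hn⟩ := Complex.exp_eq_exp_iff_exists_int.1
        ((hwz t).trans (Complex.exp_log (hne t)).symm)
      have := hN (2 * Complex.log (f (γ t)).1) (f (γ t)).2 (2 * n)
      rw [_root_.zpow_mul, zpow_ofNat, hN2, _root_.one_zpow, mul_one] at this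
      rw [← this, hn]
      push_cast
      ring_nf
    rw [h1, hg, h2, h2, γ.source, γ.target]

theorem isLocallyFlat_comap (hp : IsBranchedDoubleCover p K) (hK : IsKnot K)
    (T : Transport (Kᶜ : Set S3) Γ) (hT : ∀ e : FlatChart K, T.toFun e.circleLoop ^ 2 = 1) :
    (T.comap hp.projCompl).IsLocallyFlat := by
  intro y V hV
  by_cases hy : p y ∈ K
  · exact hp.exists_isFlatOn_of_mem T hT hy hV
  · obtain ⟨φ, hφ⟩ := hp.exists_chart hK ⟨y, hy⟩
    exact Transport.exists_isFlatOn_of_chart _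
      (hK.isClosed.isOpen_compl.preimage hp.continuous) φ ⟨y, hy⟩ hφ hV

/-- Every point of the branched cover is joined by a path to a point outside the branch set. -/
theorem exists_path (hp : IsBranchedDoubleCover p K) (y : Y) :
    ∃ b : p ⁻¹' Kᶜ, Nonempty (Path y b) := by
  by_cases hy : p y ∈ K
  · obtain ⟨e, f, hye, hfs, hft, hf⟩ := hp.branched _ hy
    have hyf : y ∈ f.source := hfs ▸ hye
    have hfc : Continuous f.symm := by
      have := f.continuousOn_symm
      rwa [hft, continuousOn_univ] at this
    have hfm : f.symm (1, 0) ∈ f.source := f.map_target (hft ▸ Set.mem_univ _)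
    refine ⟨⟨f.symm (1, 0), fun h => ?_⟩, ⟨?_⟩⟩
    · rw [e.mem_iff _ (by rw [hfs] at hfm; exact hfm), hf _ hfm,
        f.right_inv (hft ▸ Set.mem_univ _)] at h
      simp at h
    · exact ((PathConnectedSpace.somePath (f y) (1, 0)).map hfc).cast (f.left_inv hyf).symm rfl
  · exact ⟨⟨y, hy⟩, ⟨Path.refl y⟩⟩

/-- The part of the knot group that lifts to the double cover has index at most two. -/
theorem inv_mul_mem_range (hp : IsBranchedDoubleCover p K) (T : Transport (Kᶜ : Set S3) Γ)
    (b : p ⁻¹' Kᶜ) {g h : Γ} (hg : g ∈ (T.hom (hp.projCompl b)).range)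
    (hh : h ∈ (T.hom (hp.projCompl b)).range)
    (hgL : g ∉ ((T.comap hp.projCompl).hom b).range)
    (hhL : h ∉ ((T.comap hp.projCompl).hom b).range) :
    h⁻¹ * g ∈ ((T.comap hp.projCompl).hom b).range := by
  have hcov := hp.isCoveringMap_projCompl
  have hlift : ∀ g ∈ (T.hom (hp.projCompl b)).range, ∃ (c : p ⁻¹' Kᶜ) (γ : Path b c),
      hp.projCompl c = hp.projCompl b ∧ (T.comap hp.projCompl).toFun γ = g := by
    intro g hg
    obtain ⟨γ, rfl⟩ := T.mem_range_hom_iff.1 hg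
    have hl := fun t => congrFun (hcov.liftPath_lifts γ b γ.source) t
    refine ⟨_, ⟨hcov.liftPath γ b γ.source, hcov.liftPath_zero γ b γ.source, rfl⟩,
      (hl 1).trans γ.target, ?_⟩
    exact T.congr _ _ hl
  obtain ⟨c, γ, hc, rfl⟩ := hlift g hg
  obtain ⟨d, δ, hd, rfl⟩ := hlift h hh
  rw [Transport.mem_range_hom_iff] at hgL hhL ⊢
  have hcb : c ≠ b := by
    rintro rfl
    exact hgL ⟨γ, rfl⟩
  have hdb : d ≠ b := by
    rintro rfl
    exact hhL ⟨δ, rfl⟩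
  -- The fibre has two points, so lifts of two loops that do not close up both end at the point
  -- other than $b$.
  obtain rfl : c = d := by
    obtain ⟨u, v, -, huv⟩ := Set.ncard_eq_two.1 (hp.two_sheeted _ (hp.projCompl b).2)
    have h1 : ∀ a : p ⁻¹' Kᶜ, hp.projCompl a = hp.projCompl b → (a : Y) = u ∨ (a : Y) = v := by
      intro a ha
      have : (a : Y) ∈ p ⁻¹' {((hp.projCompl b : (Kᶜ : Set S3)) : S3)} := congrArg Subtype.val ha
      rw [huv] at this
      exact this
    have hcb' : (c : Y) ≠ b := fun h => hcb (Subtype.ext h)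
    have hdb' : (d : Y) ≠ b := fun h => hdb (Subtype.ext h)
    refine Subtype.ext ?_
    rcases h1 b rfl with h | h <;> rcases h1 c hc with h' | h' <;> rcases h1 d hd with h'' | h'' <;>
      simp_all
  exact ⟨γ.trans δ.symm, by rw [Transport.trans, Transport.symm]⟩

end IsBranchedDoubleCover

/-! ### From meridians of order two to a dihedral image. -/

theorem coverSO3_quatI_sq : coverSO3 quatI ^ 2 = 1 := by
  have h : ((coverSO3 quatI : SO3) : Matrix (Fin 3) (Fin 3) ℝ) =
      !![-1, 0, 0; 0, -1, 0; 0, 0, 1] := by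
    have hq : (quatI : Matrix (Fin 2) (Fin 2) ℂ) = !![⟨0, 1⟩, ⟨0, 0⟩; ⟨-0, 0⟩, ⟨0, -1⟩] := by
      ext i j
      fin_cases i <;> fin_cases j <;> apply Complex.ext <;> simp [quatI]
    change rotationMatrix quatI = _
    rw [hq, rotationMatrix_coords]
    simp
  refine Subtype.ext ?_
  rw [SubmonoidClass.coe_pow, h, sq]
  ext i j
  fin_cases i <;> fin_cases j <;> simp [Matrix.mul_apply, Fin.sum_univ_three]

end

theorem proposition3p1 (K : Set S3) (hK : IsKnot K)
    {Y : Type*} [TopologicalSpace Y] (p : Y → S3) (hp : IsBranchedDoubleCover p K) (y₀ : Y)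
    (hcyc : HasOnlyCyclicSO3Reps (FundamentalGroup Y y₀)) :
    IsSU2Simple K := by
  rintro x₀ m ⟨e₁, γ, hm⟩ ρ hρ
  have := hK.pathConnectedSpace_compl x₀
  obtain ⟨T, hT, hT1⟩ := Transport.exists_of_hom (coverSO3.comp ρ)
  have hmsq : (coverSO3.comp ρ) m ^ 2 = 1 := by
    obtain ⟨c, hc⟩ := isConj_iff.1 (show IsConj (ρ m) quatI from hρ)
    have : ρ m = c⁻¹ * quatI * c := by rw [← hc]; group
    rw [MonoidHom.comp_apply, this, map_mul, map_mul, map_inv]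
    have h2 := conj_pow (i := 2) (a := (coverSO3 c)⁻¹) (b := coverSO3 quatI)
    rw [inv_inv, coverSO3_quatI_sq] at h2
    rw [h2]
    group
  have hcirc : T.toFun e₁.circleLoop ^ 2 = 1 := by
    rw [hm, ← hT, T.trans, T.trans, T.symm] at hmsq
    have h2 := conj_pow (i := 2) (a := (T.toFun γ)⁻¹) (b := T.toFun e₁.circleLoop)
    rw [inv_inv, hmsq, eq_comm, mul_assoc, inv_mul_eq_one] at h2
    simpa using h2
  have hTe : ∀ e : FlatChart K, T.toFun e.circleLoop ^ 2 = 1 := fun e =>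
    hK.circleLoop_sq_eq_one T e₁ e hcirc
  obtain ⟨T', hT'⟩ := (hp.isLocallyFlat_comap hK T hTe).exists_extension
  obtain ⟨b, ⟨δ⟩⟩ := hp.exists_path y₀
  obtain ⟨C, hC, hCle⟩ := hcyc (T'.hom y₀)
  obtain ⟨n, hn, hCn⟩ := SO3.exists_common_fixed_vector C hC
  obtain ⟨n', hn', hR⟩ := SO3.exists_plane (R := (T.hom (hp.projCompl b)).range)
    (L := ((T.comap hp.projCompl).hom b).range)
    (fun A hA => by
      obtain ⟨γ, rfl⟩ := Transport.mem_range_hom_iff _ |>.1 hA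
      exact T.mem_range_hom_iff.2 ⟨_, rfl⟩)
    (fun g hg h hh hgL hhL => by
      -- Applied to $g^{-1},h^{-1}$ this gives $hg^{-1}\in L$, the inverse of the required element.
      have := hp.inv_mul_mem_range T b (inv_mem hg) (inv_mem hh) (fun h => hgL (inv_mem_iff.1 h))
        (fun h => hhL (inv_mem_iff.1 h))
      rw [← inv_mem_iff]
      simpa using this)
    -- Moving the base point from $y_0$ to $b$ along $\delta$ conjugates the image, so the common
    -- axis is moved by the transport of $\delta$.
    ⟨(T'.toFun δ : Matrix (Fin 3) (Fin 3) ℝ) *ᵥ n, fun h => hn (by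
      rw [eq_comm, ← SO3.inv_mulVec_eq_iff, Matrix.mulVec_zero] at h
      exact h.symm), fun A hA => by
      obtain ⟨γ, rfl⟩ := Transport.mem_range_hom_iff _ |>.1 hA
      have h1 := hCn _ (hCle (T'.mem_range_hom_iff.2
        ⟨(δ.trans (γ.map continuous_subtype_val)).trans δ.symm, rfl⟩))
      rw [T'.trans, T'.trans, T'.symm, hT', SO3.mul_mulVec, SO3.mul_mulVec,
        SO3.inv_mulVec_eq_iff] at h1
      exact h1⟩
  refine ⟨Subgroup.closure ((coverSO3.comp ρ).range : Set SO3), ⟨n', hn', _, fun A hA => hR A ?_,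
    rfl⟩, Subgroup.subset_closure⟩
  obtain ⟨α, rfl⟩ := hA
  induction α using Quotient.inductionOn with | _ α
  -- A path of trivial transport changes the base point without conjugating the image.
  obtain ⟨c, hc⟩ := hT1 (hp.projCompl b)
  refine T.mem_range_hom_iff.2 ⟨c.symm.trans (α.trans c), ?_⟩
  rw [T.trans, T.trans, T.symm, hc, inv_one, mul_one, one_mul, hT]
  rfl
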